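/- There are absolute constants $C, c > 0$ with the following property. Let $n, m$ be non-negative integers and let $s \le n$ be a real number, and put $$K_{n,s} = \{z \in \mathbb{R}^n : \|z\|_2 \le 1,\ \|z\|_1 \le \sqrt{s}\}.$$ Let $a_1,\dots,a_m$ be independent standard Gaussian random vectors in $\mathbb{R}^n$, and fix $x \in \mathbb{R}^n$, $x \neq 0$, with $x/\|x\|_2 \in K_{n,s}$ (this forces $s \ge 1$). Suppose that $y_1,\dots,y_m$ follow the logistic regression model: given $a_1,\dots,a_m$, the $y_i$ are independent $\{-1,1\}$-valued random variables with $$\mathbb{P}(y_i = 1 \mid a_1,\dots,a_m) = f(\langle a_i, x\rangle), \qquad f(z) = \frac{e^z}{e^z+1}.$$ Let $\delta > 0$ and suppose that $$m \ge C \delta^{-2} s \log(2n/s).$$ Then, with probability at least $1 - 8\exp(-c\delta^2 m)$, the convex program $$\max\ \sum_{i=1}^m y_i \langle a_i, x'\rangle \quad \text{subject to} \quad \|x'\|_1 \le \sqrt{s},\ \|x'\|_2 \le 1$$ has a solution, and every solution $\hat{x}$ of it satisfies $$\Big\| \hat{x} - \frac{x}{\|x\|_2} \Big\|_2^2 \le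 \delta \max\big(\|x\|_2^{-1}, 1\big).$$ -/

import Mathlib

open MeasureTheory ProbabilityTheory

noncomputable section

/-- The logistic function `f z = e ^ z / (e ^ z + 1)`. -/
def logisticFun (z : ℝ) : ℝ := Real.exp z / (Real.exp z + 1)

/-- The set `K_{n,s}` of approximately `s`-sparse vectors: Euclidean norm at most `1` and
`ℓ₁` norm at most `√s`. -/
def compressibleSet (n : ℕ) (s : ℝ) : Set (EuclideanSpace ℝ (Fin n)) :=
  {z | ‖z‖ ≤ 1 ∧ ∑ j, |z j| ≤ Real.sqrt s}

/-- `z` is a solution of the convex program: maximize `∑ i, y i * ⟪a i, z'⟫` subject to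
`‖z'‖₁ ≤ √s` and `‖z'‖₂ ≤ 1`. -/
def IsProgramSolution {n m : ℕ} (s : ℝ) (a : Fin m → EuclideanSpace ℝ (Fin n)) (y : Fin m → ℝ)
    (z : EuclideanSpace ℝ (Fin n)) : Prop :=
  z ∈ compressibleSet n s ∧
    IsMaxOn (fun z' => ∑ i, y i * inner ℝ (a i) z') (compressibleSet n s) z

/-- The σ-algebra generated by the measurement vectors `a 1, …, a m`. -/
abbrev measurementSigma {Ω : Type*} {n m : ℕ} (a : Fin m → Ω → EuclideanSpace ℝ (Fin n)) :
    MeasurableSpace Ω :=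
  ⨆ i, MeasurableSpace.comap (a i) inferInstance

/-- Conditional independence of real random variables `y i` given a σ-algebra `𝒜`. On standard Borel
spaces this is `ProbabilityTheory.iCondIndepFun`, by
`iCondIndepFun_iff_condExp_inter_preimage_eq_mul`; here no condition on `Ω` is imposed. -/
def CondIndepGiven {Ω ι : Type*} (𝒜 : MeasurableSpace Ω) [MeasurableSpace Ω] (μ : Measure Ω)
    (y : ι → Ω → ℝ) : Prop :=
  ∀ (S : Finset ι) (B : ι → Set ℝ), (∀ i ∈ S, MeasurableSet (B i)) →
    μ⟦⋂ i ∈ S, y i ⁻¹' B i | 𝒜⟧ =ᵐ[μ] ∏ i ∈ S, μ⟦y i ⁻¹' B i | 𝒜⟧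

/-- The logistic regression model with signal `x` and Gaussian design: the `a i` are independent
standard Gaussian vectors and, given the `a i`, the `y i` are independent `{-1, 1}`-valued random
variables with `ℙ(y i = 1) = f (⟪a i, x⟫)`. -/
structure IsGaussianLogisticModel {Ω : Type*} [MeasurableSpace Ω] (μ : Measure Ω) {n m : ℕ}
    (x : EuclideanSpace ℝ (Fin n)) (a : Fin m → Ω → EuclideanSpace ℝ (Fin n))
    (y : Fin m → Ω → ℝ) : Prop where
  measurable_a : ∀ i, Measurable (a i)
  measurable_y : ∀ i, Measurable (y i)
  gaussian_a : ∀ i, HasLaw (a i) (stdGaussian (EuclideanSpace ℝ (Fin n))) μ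
  indep_a : iIndepFun a μ
  sign_y : ∀ i ω, y i ω = -1 ∨ y i ω = 1
  condIndep_y : CondIndepGiven (measurementSigma a) μ y
  prob_y : ∀ i, μ⟦y i ⁻¹' {1} | measurementSigma a⟧ =ᵐ[μ]
    fun ω => logisticFun (inner ℝ (a i ω) x)

end

/-!
Write `u = x / ‖x‖₂`. As `y i = ± 1`, the random variable `y i * ⟪a i, θ⟫` is dominated by the
Gaussian variable `⟪a i, θ⟫`, and it has mean `λ * ⟪u, θ⟫` by the invariance of the Gaussian law
under the reflection fixing `u`. Hence `V = ∑ i, y i • a i - (m * λ) • u` is a sum of independent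
centred sub-Gaussian vectors. For `z` in `K_{n,s}` one has `⟪V, z⟫ ≤ τ * √s + ‖T V‖₂`, where `T` is
soft thresholding of the coordinates at `τ = √(8 m log (2n / s))`; Gaussian decoupling bounds the
exponential moments of `∑ j ∈ S, V j ^ 2` over sets `S` of coordinates, hence that of `‖T V‖₂ ^ 2`.
Finally, optimality of a solution `z` gives `m * λ * ‖z - u‖ ^ 2 ≤ 4 * sup_{w ∈ K} ⟪V, w⟫`, and `λ`
is at least a constant multiple of `min ‖x‖₂ 1`.
-/

/-! ### Sub-Gaussian random variables and vectors -/

section Subgaussian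

variable {Ω : Type*} [MeasurableSpace Ω] {μ : Measure Ω} {X Z : Ω → ℝ}

lemma integrable_exp_mul_of_ae_abs_le {t : ℝ} (hX : AEMeasurable X μ)
    (hpos : Integrable (fun ω => Real.exp (t * Z ω)) μ)
    (hneg : Integrable (fun ω => Real.exp (-t * Z ω)) μ) (hXZ : ∀ᵐ ω ∂μ, |X ω| ≤ |Z ω|) :
    Integrable (fun ω => Real.exp (t * X ω)) μ := by
  refine (hpos.add hneg).mono' (by fun_prop) ?_
  filter_upwards [hXZ] with ω hω
  calc ‖Real.exp (t * X ω)‖ = Real.exp (t * X ω) := by rw [Real.norm_eq_abs, Real.abs_exp]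
    _ ≤ Real.exp |t * Z ω| := by
      gcongr
      exact (le_abs_self _).trans (by rw [abs_mul, abs_mul]; gcongr)
    _ ≤ Real.exp (t * Z ω) + Real.exp (-t * Z ω) := by
      rw [neg_mul]
      exact Real.exp_abs_le _

lemma mgf_add_mgf_neg_le_of_ae_abs_le {t : ℝ} (hX : AEMeasurable X μ)
    (hpos : Integrable (fun ω => Real.exp (t * Z ω)) μ)
    (hneg : Integrable (fun ω => Real.exp (-t * Z ω)) μ) (hXZ : ∀ᵐ ω ∂μ, |X ω| ≤ |Z ω|) :
    mgf X μ t + mgf X μ (-t) ≤ mgf Z μ t + mgf Z μ (-t) := by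
  have hXpos := integrable_exp_mul_of_ae_abs_le hX hpos hneg hXZ
  have hXneg := integrable_exp_mul_of_ae_abs_le (t := -t) hX hneg (by rwa [neg_neg]) hXZ
  simp only [mgf]
  rw [← integral_add hXpos hXneg, ← integral_add hpos hneg]
  refine integral_mono_ae (hXpos.add hXneg) (hpos.add hneg) ?_
  filter_upwards [hXZ] with ω hω
  have hcosh : Real.cosh (t * X ω) ≤ Real.cosh (t * Z ω) := by
    rw [Real.cosh_le_cosh, abs_mul, abs_mul]
    gcongr
  rw [Real.cosh_eq, Real.cosh_eq] at hcosh
  simp only [neg_mul]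
  linarith

/- Jensen's inequality bounds the factor `exp (-t 𝔼X)` by `mgf X (-t)`, and the product
`mgf X t * mgf X (-t)` is at most the square of the mean of its factors. -/
lemma hasSubgaussianMGF_sub_integral_of_ae_abs_le [IsProbabilityMeasure μ] {c : NNReal}
    (hX : AEMeasurable X μ) (hZ : HasSubgaussianMGF Z c μ) (hXZ : ∀ᵐ ω ∂μ, |X ω| ≤ |Z ω|) :
    HasSubgaussianMGF (fun ω => X ω - ∫ ω, X ω ∂μ) (2 * c) μ := by
  have hexpX t : Integrable (fun ω => Real.exp (t * X ω)) μ :=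
    integrable_exp_mul_of_ae_abs_le hX (hZ.integrable_exp_mul t) (hZ.integrable_exp_mul (-t)) hXZ
  have hshift t : (fun ω => Real.exp (t * (X ω - ∫ ω, X ω ∂μ))) =
      fun ω => Real.exp (-t * ∫ ω, X ω ∂μ) * Real.exp (t * X ω) := by
    funext ω
    rw [← Real.exp_add]
    ring_nf
  refine ⟨fun t => hshift t ▸ (hexpX t).const_mul _, fun t => ?_⟩
  have hX_int : Integrable X μ := hZ.integrable.mono hX.aestronglyMeasurable hXZ
  have hjensen : Real.exp (-t * ∫ ω, X ω ∂μ) ≤ mgf X μ (-t) := by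
    rw [← integral_const_mul]
    exact convexOn_exp.map_integral_le Real.continuous_exp.continuousOn isClosed_univ
      (ae_of_all _ fun _ => Set.mem_univ _) (hX_int.const_mul _) (hexpX (-t))
  have hmean : mgf X μ t + mgf X μ (-t) ≤ 2 * Real.exp (c * t ^ 2 / 2) := by
    have hZpos := hZ.mgf_le t
    have hZneg := hZ.mgf_le (-t)
    rw [neg_sq] at hZneg
    linarith [mgf_add_mgf_neg_le_of_ae_abs_le hX (hZ.integrable_exp_mul t)
      (hZ.integrable_exp_mul (-t)) hXZ]
  have hmgf_nonneg s : 0 ≤ mgf X μ s := mgf_nonneg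
  calc mgf (fun ω => X ω - ∫ ω, X ω ∂μ) μ t
      = Real.exp (-t * ∫ ω, X ω ∂μ) * mgf X μ t := by
        rw [mgf, hshift, integral_const_mul, mgf]
    _ ≤ mgf X μ (-t) * mgf X μ t := by gcongr; exact hmgf_nonneg t
    _ ≤ Real.exp (c * t ^ 2 / 2) ^ 2 := by
        nlinarith [sq_nonneg (mgf X μ t - mgf X μ (-t)), hmgf_nonneg t, hmgf_nonneg (-t)]
    _ = Real.exp ((2 * c : NNReal) * t ^ 2 / 2) := by
        rw [← Real.exp_nat_mul]
        push_cast
        ring_nf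

end Subgaussian

section GaussianReal

variable {v : NNReal} {a : ℝ} {κ : Type*} [Fintype κ]

lemma gaussianPDFReal_mul_exp_sq (hv : v ≠ 0) (z : ℝ) :
    gaussianPDFReal 0 v z * Real.exp (a * z ^ 2) =
      (√(2 * Real.pi * v))⁻¹ * Real.exp (-((1 - 2 * a * v) / (2 * v)) * z ^ 2) := by
  rw [gaussianPDFReal, mul_assoc, ← Real.exp_add]
  congr 2
  field_simp
  ring

lemma integrable_exp_sq_gaussianReal (ha : 2 * a * v < 1) :
    Integrable (fun z => Real.exp (a * z ^ 2)) (gaussianReal 0 v) := by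
  rcases eq_or_ne v 0 with rfl | hv
  · rw [gaussianReal_zero_var]
    exact integrable_dirac enorm_lt_top
  have : (0 : ℝ) < v := by positivity
  rw [gaussianReal_of_var_ne_zero _ hv, integrable_withDensity_iff_integrable_smul'
    (measurable_gaussianPDF _ _) (ae_of_all _ fun _ => gaussianPDF_lt_top)]
  simp only [gaussianPDF, ENNReal.toReal_ofReal (gaussianPDFReal_nonneg _ _ _), smul_eq_mul,
    gaussianPDFReal_mul_exp_sq hv]
  exact (integrable_exp_neg_mul_sq (div_pos (by linarith) (by positivity))).const_mul _

lemma integral_exp_sq_gaussianReal (ha : 2 * a * v < 1) :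
    ∫ z, Real.exp (a * z ^ 2) ∂(gaussianReal 0 v) = (√(1 - 2 * a * v))⁻¹ := by
  rcases eq_or_ne v 0 with rfl | hv
  · simp
  have : (0 : ℝ) < v := by positivity
  have : 0 < 1 - 2 * a * v := by linarith
  rw [integral_gaussianReal_eq_integral_smul hv]
  simp only [smul_eq_mul, gaussianPDFReal_mul_exp_sq hv]
  rw [integral_const_mul, integral_gaussian, ← Real.sqrt_inv, ← Real.sqrt_inv,
    ← Real.sqrt_mul (by positivity)]
  congr 1
  field_simp

lemma lintegral_exp_sum_mul_pi_gaussianReal (t : κ → ℝ) :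
    ∫⁻ g, ENNReal.ofReal (Real.exp (∑ k, t k * g k)) ∂(Measure.pi fun _ => gaussianReal 0 v) =
      ENNReal.ofReal (Real.exp (∑ k, v * t k ^ 2 / 2)) := by
  simp only [Real.exp_sum]
  rw [← ofReal_integral_eq_lintegral_ofReal
    (Integrable.fintype_prod fun k => integrable_exp_mul_gaussianReal (t k))
    (ae_of_all _ fun _ => by positivity),
    integral_fintype_prod_eq_prod (f := fun k z => Real.exp (t k * z))]
  congr 2
  funext k
  simpa [mgf] using congrFun (mgf_fun_id_gaussianReal (μ := 0) (v := v)) (t k)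

lemma lintegral_exp_sum_sq_pi_gaussianReal (ha : 2 * a * v < 1) :
    ∫⁻ g : κ → ℝ, ENNReal.ofReal (Real.exp (∑ k, a * g k ^ 2))
        ∂(Measure.pi fun _ => gaussianReal 0 v) =
      ENNReal.ofReal ((√(1 - 2 * a * v))⁻¹ ^ Fintype.card κ) := by
  simp only [Real.exp_sum]
  rw [← ofReal_integral_eq_lintegral_ofReal
    (Integrable.fintype_prod fun _ => integrable_exp_sq_gaussianReal ha)
    (ae_of_all _ fun _ => by positivity),
    integral_fintype_prod_eq_pow (f := fun z => Real.exp (a * z ^ 2)),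
    integral_exp_sq_gaussianReal ha]

end GaussianReal

section SubgaussianVector

variable {Ω : Type*} [MeasurableSpace Ω] {μ : Measure Ω}
  {E : Type*} [NormedAddCommGroup E] [InnerProductSpace ℝ E]

/-- `V` is a sub-Gaussian random vector with variance proxy `c`: every marginal `⟪V, θ⟫` is a
sub-Gaussian random variable with variance proxy `c * ‖θ‖ ^ 2`. In particular `V` is centred. -/
def IsSubgaussianVector (V : Ω → E) (c : NNReal) (μ : Measure Ω) : Prop :=
  ∀ θ : E, HasSubgaussianMGF (fun ω => inner ℝ (V ω) θ) (c * ‖θ‖₊ ^ 2) μ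

namespace IsSubgaussianVector

variable {V : Ω → E} {c : NNReal} {κ : Type*} [Fintype κ] {e : κ → E}

lemma lintegral_exp_inner_le (hV : IsSubgaussianVector V c μ) (θ : E) :
    ∫⁻ ω, ENNReal.ofReal (Real.exp (inner ℝ (V ω) θ)) ∂μ ≤
      ENNReal.ofReal (Real.exp (c * ‖θ‖ ^ 2 / 2)) := by
  have hint := (hV θ).integrable_exp_mul 1
  have hmgf := (hV θ).mgf_le 1
  simp only [mgf, one_mul] at hint hmgf
  rw [← ofReal_integral_eq_lintegral_ofReal hint (ae_of_all _ fun _ => (Real.exp_pos _).le)]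
  exact ENNReal.ofReal_le_ofReal (by simpa using hmgf)

/- Decoupling: `exp (∑ tₖ² / (4 c))` is the moment generating function at `t` of a Gaussian vector
`g` with independent coordinates of variance `1 / (2 c)`; after exchanging the two integrals, the
sub-Gaussian bound for `V` is applied at `∑ gₖ eₖ`. -/
lemma lintegral_exp_sum_sq_inner_le [SFinite μ] (hV : IsSubgaussianVector V c μ) (hc : 0 < c)
    (he : Orthonormal ℝ e) :
    ∫⁻ ω, ENNReal.ofReal (Real.exp (∑ k, inner ℝ (V ω) (e k) ^ 2 / (4 * c))) ∂μ ≤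
      ENNReal.ofReal (√2 ^ Fintype.card κ) := by
  set γ : Measure (κ → ℝ) := Measure.pi fun _ => gaussianReal 0 (2 * c)⁻¹ with hγ
  have hinner ω (g : κ → ℝ) :
      ∑ k, inner ℝ (V ω) (e k) * g k = inner ℝ (V ω) (∑ k, g k • e k) := by
    simp only [inner_sum, real_inner_smul_right, mul_comm]
  have hnorm (g : κ → ℝ) : c * ‖∑ k, g k • e k‖ ^ 2 / 2 = ∑ k, c / 2 * g k ^ 2 := by
    rw [← real_inner_self_eq_norm_sq, he.inner_sum, ← Finset.mul_sum]
    simp only [conj_trivial, sq]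
    ring
  have hvar : 2 * (c / 2 : ℝ) * ((2 * c)⁻¹ : NNReal) = 1 / 2 := by
    push_cast
    field_simp
  have hmeas k : AEMeasurable (fun p : Ω × (κ → ℝ) => inner ℝ (V p.1) (e k)) (μ.prod γ) :=
    (hV (e k)).aemeasurable.comp_fst
  calc ∫⁻ ω, ENNReal.ofReal (Real.exp (∑ k, inner ℝ (V ω) (e k) ^ 2 / (4 * c))) ∂μ
      = ∫⁻ ω, ∫⁻ g, ENNReal.ofReal (Real.exp (∑ k, inner ℝ (V ω) (e k) * g k)) ∂γ ∂μ := by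
        simp only [hγ, lintegral_exp_sum_mul_pi_gaussianReal]
        refine lintegral_congr fun ω => ?_
        congr! 3
        push_cast
        field_simp
        norm_num
    _ = ∫⁻ g, ∫⁻ ω, ENNReal.ofReal (Real.exp (∑ k, inner ℝ (V ω) (e k) * g k)) ∂μ ∂γ :=
        lintegral_lintegral_swap (by
          refine (Real.measurable_exp.comp_aemeasurable ?_).ennreal_ofReal
          exact Finset.aemeasurable_fun_sum _ fun k _ => (hmeas k).mul (by fun_prop))
    _ ≤ ∫⁻ g, ENNReal.ofReal (Real.exp (c * ‖∑ k, g k • e k‖ ^ 2 / 2)) ∂γ := by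
        simp only [hinner]
        exact lintegral_mono fun g => hV.lintegral_exp_inner_le _
    _ = ENNReal.ofReal (√2 ^ Fintype.card κ) := by
        simp only [hnorm]
        rw [lintegral_exp_sum_sq_pi_gaussianReal (by rw [hvar]; norm_num), hvar, ← Real.sqrt_inv]
        norm_num

lemma lintegral_prod_one_add_exp_sq_inner_le [SFinite μ] (hV : IsSubgaussianVector V c μ)
    (hc : 0 < c) (he : Orthonormal ℝ e) {q : ℝ} (hq : 0 ≤ q) :
    ∫⁻ ω, ENNReal.ofReal (∏ k, (1 + q * Real.exp (inner ℝ (V ω) (e k) ^ 2 / (4 * c)))) ∂μ ≤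
      ENNReal.ofReal ((1 + q * √2) ^ Fintype.card κ) := by
  have hmeas k : AEMeasurable (fun ω => inner ℝ (V ω) (e k)) μ := (hV (e k)).aemeasurable
  have hterm_nonneg (S : Finset κ) (t : ℝ) : 0 ≤ q ^ S.card * Real.exp t := by positivity
  have hexpand : ∀ f : κ → ℝ, ∏ k, (1 + q * Real.exp (f k)) =
      ∑ S : Finset κ, q ^ S.card * Real.exp (∑ k : S, f k) := fun f => by
    rw [Finset.prod_one_add, Finset.powerset_univ]
    refine Finset.sum_congr rfl fun S _ => ?_
    rw [Finset.prod_mul_distrib, Finset.prod_const, Finset.sum_coe_sort, Real.exp_sum]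
  have hbinomial : ∑ S : Finset κ, q ^ S.card * √2 ^ S.card = (1 + q * √2) ^ Fintype.card κ := by
    rw [← Finset.card_univ, ← Finset.prod_const, Finset.prod_one_add, Finset.powerset_univ]
    simp only [Finset.prod_const, mul_pow]
  calc ∫⁻ ω, ENNReal.ofReal (∏ k, (1 + q * Real.exp (inner ℝ (V ω) (e k) ^ 2 / (4 * c)))) ∂μ
      = ∑ S : Finset κ, ENNReal.ofReal (q ^ S.card) * ∫⁻ ω, ENNReal.ofReal
          (Real.exp (∑ k : S, inner ℝ (V ω) (e k) ^ 2 / (4 * c))) ∂μ := by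
        simp only [hexpand]
        simp only [ENNReal.ofReal_sum_of_nonneg fun S _ => hterm_nonneg S _,
          ENNReal.ofReal_mul (pow_nonneg hq _)]
        rw [lintegral_finsetSum']
        · simp only [lintegral_const_mul' _ _ ENNReal.ofReal_ne_top]
        · intro S _
          fun_prop
    _ ≤ ∑ S : Finset κ, ENNReal.ofReal (q ^ S.card) * ENNReal.ofReal (√2 ^ S.card) := by
        gcongr with S
        simpa using hV.lintegral_exp_sum_sq_inner_le hc
          (he.comp ((↑) : S → κ) Subtype.val_injective)
    _ = ENNReal.ofReal ((1 + q * √2) ^ Fintype.card κ) := by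
        rw [← hbinomial, ENNReal.ofReal_sum_of_nonneg fun S _ => by positivity]
        simp only [ENNReal.ofReal_mul (pow_nonneg hq _)]

end IsSubgaussianVector

end SubgaussianVector

/-! ### Compressible vectors and soft thresholding -/

section CompressibleSet

variable {n : ℕ} {s : ℝ}

lemma neg_mem_compressibleSet {z : EuclideanSpace ℝ (Fin n)} (hz : z ∈ compressibleSet n s) :
    -z ∈ compressibleSet n s := by
  simpa [compressibleSet] using hz

lemma isCompact_compressibleSet : IsCompact (compressibleSet n s) := by
  refine Metric.isCompact_of_isClosed_isBounded ?_ ?_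
  · exact (isClosed_le continuous_norm continuous_const).inter
      (isClosed_le (f := fun z : EuclideanSpace ℝ (Fin n) => ∑ j, |z j|) (by fun_prop)
        continuous_const)
  · exact (Metric.isBounded_closedBall (x := 0) (r := 1)).subset fun z hz =>
      mem_closedBall_zero_iff.2 hz.1

lemma one_le_of_mem_compressibleSet {u : EuclideanSpace ℝ (Fin n)} (hu : ‖u‖ = 1)
    (huK : u ∈ compressibleSet n s) : 1 ≤ s := by
  refine Real.one_le_sqrt.1 (le_trans ?_ huK.2)
  calc (1 : ℝ) = ∑ j, |u j| * |u j| := by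
        have hsq := EuclideanSpace.norm_sq_eq u
        rw [hu] at hsq
        simpa [sq] using hsq
    _ ≤ ∑ j, |u j| * 1 := by
        gcongr with j
        simpa [hu] using PiLp.norm_apply_le u j
    _ = ∑ j, |u j| := by simp only [mul_one]

end CompressibleSet

section SoftThreshold

variable {ι : Type*} [Fintype ι]

lemma inner_le_mul_sum_abs_add_sqrt_sum_softThreshold_sq_mul_norm (τ : ℝ)
    (v z : EuclideanSpace ℝ ι) :
    inner ℝ v z ≤ τ * ∑ j, |z j| + √(∑ j, max (|v j| - τ) 0 ^ 2) * ‖z‖ := by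
  have hcoord j : v j * z j ≤ τ * |z j| + max (|v j| - τ) 0 * |z j| := by
    rw [← add_mul]
    calc v j * z j ≤ |v j| * |z j| := by rw [← abs_mul]; exact le_abs_self _
      _ ≤ (τ + max (|v j| - τ) 0) * |z j| := by
        gcongr
        linarith [le_max_left (|v j| - τ) 0]
  calc inner ℝ v z = ∑ j, v j * z j := by simp [PiLp.inner_apply, mul_comm]
    _ ≤ ∑ j, (τ * |z j| + max (|v j| - τ) 0 * |z j|) := Finset.sum_le_sum fun j _ => hcoord j
    _ = τ * ∑ j, |z j| + ∑ j, max (|v j| - τ) 0 * |z j| := by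
        rw [Finset.sum_add_distrib, Finset.mul_sum]
    _ ≤ τ * ∑ j, |z j| + √(∑ j, max (|v j| - τ) 0 ^ 2) * √(∑ j, |z j| ^ 2) := by
        gcongr
        exact Real.sum_mul_le_sqrt_mul_sqrt _ _ _
    _ = τ * ∑ j, |z j| + √(∑ j, max (|v j| - τ) 0 ^ 2) * ‖z‖ := by
        simp only [EuclideanSpace.norm_eq, Real.norm_eq_abs]

lemma inner_le_of_mem_compressibleSet {n : ℕ} {s τ r : ℝ} (hτ : 0 ≤ τ) (hr : 0 ≤ r)
    {v z : EuclideanSpace ℝ (Fin n)} (hv : ∑ j, max (|v j| - τ) 0 ^ 2 ≤ r ^ 2)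
    (hz : z ∈ compressibleSet n s) : inner ℝ v z ≤ τ * √s + r := by
  calc inner ℝ v z ≤ τ * ∑ j, |z j| + √(∑ j, max (|v j| - τ) 0 ^ 2) * ‖z‖ :=
        inner_le_mul_sum_abs_add_sqrt_sum_softThreshold_sq_mul_norm τ v z
    _ ≤ τ * √s + r * 1 := by
        gcongr
        exacts [hz.2, Real.sqrt_le_iff.2 ⟨hr, hv⟩, hz.1]
    _ = τ * √s + r := by rw [mul_one]

lemma exp_softThreshold_sq_div_le {τ b : ℝ} (hτ : 0 ≤ τ) (hb : 0 < b) (v : ℝ) :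
    Real.exp (max (|v| - τ) 0 ^ 2 / b) ≤
      1 + Real.exp (-(τ ^ 2 / b)) * Real.exp (v ^ 2 / b) := by
  rcases le_total |v| τ with h | h
  · rw [max_eq_right (sub_nonpos.2 h), zero_pow two_ne_zero, zero_div, Real.exp_zero]
    exact le_add_of_nonneg_right (by positivity)
  · rw [max_eq_left (sub_nonneg.2 h), ← Real.exp_add]
    have hsq : (|v| - τ) ^ 2 / b ≤ -(τ ^ 2 / b) + v ^ 2 / b := by
      rw [← neg_div, ← add_div, ← sq_abs v]
      gcongr
      nlinarith
    linarith [Real.exp_le_exp.2 hsq]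

variable {Ω : Type*} [MeasurableSpace Ω] {μ : Measure Ω} {c : NNReal}

lemma IsSubgaussianVector.lintegral_exp_sum_softThreshold_sq_le [SFinite μ]
    {V : Ω → EuclideanSpace ℝ ι} (hV : IsSubgaussianVector V c μ) (hc : 0 < c) {τ : ℝ}
    (hτ : 0 ≤ τ) :
    ∫⁻ ω, ENNReal.ofReal (Real.exp ((∑ j, max (|V ω j| - τ) 0 ^ 2) / (4 * c))) ∂μ ≤
      ENNReal.ofReal (Real.exp (√2 * Fintype.card ι * Real.exp (-(τ ^ 2 / (4 * c))))) := by
  set q := Real.exp (-(τ ^ 2 / (4 * c)))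
  have hprod := hV.lintegral_prod_one_add_exp_sq_inner_le hc
    (EuclideanSpace.basisFun ι ℝ).orthonormal (q := q) (Real.exp_pos _).le
  simp only [EuclideanSpace.inner_basisFun_real] at hprod
  calc ∫⁻ ω, ENNReal.ofReal (Real.exp ((∑ j, max (|V ω j| - τ) 0 ^ 2) / (4 * c))) ∂μ
      ≤ ∫⁻ ω, ENNReal.ofReal (∏ j, (1 + q * Real.exp (V ω j ^ 2 / (4 * c)))) ∂μ := by
        refine lintegral_mono fun ω => ENNReal.ofReal_le_ofReal ?_
        rw [Finset.sum_div, Real.exp_sum]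
        exact Finset.prod_le_prod (fun _ _ => (Real.exp_pos _).le) fun j _ =>
          exp_softThreshold_sq_div_le hτ (by positivity) _
    _ ≤ ENNReal.ofReal ((1 + q * √2) ^ Fintype.card ι) := hprod
    _ ≤ ENNReal.ofReal (Real.exp (√2 * Fintype.card ι * q)) := by
        gcongr
        calc (1 + q * √2) ^ Fintype.card ι ≤ Real.exp (q * √2) ^ Fintype.card ι := by
              gcongr
              linarith [Real.add_one_le_exp (q * √2)]
          _ = Real.exp (√2 * Fintype.card ι * q) := by
              rw [← Real.exp_nat_mul]
              ring_nf

lemma IsSubgaussianVector.measureReal_lt_sum_softThreshold_sq_le [SFinite μ]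
    {V : Ω → EuclideanSpace ℝ ι} (hV : IsSubgaussianVector V c μ) (hc : 0 < c) {τ : ℝ}
    (hτ : 0 ≤ τ) (r : ℝ) :
    μ.real {ω | r ^ 2 < ∑ j, max (|V ω j| - τ) 0 ^ 2} ≤
      Real.exp (√2 * Fintype.card ι * Real.exp (-(τ ^ 2 / (4 * c))) - r ^ 2 / (4 * c)) := by
  have hmeas j : AEMeasurable (fun ω => V ω j) μ := by
    simpa using (hV (EuclideanSpace.basisFun ι ℝ j)).aemeasurable
  refine ENNReal.toReal_le_of_le_ofReal (Real.exp_pos _).le ?_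
  calc μ {ω | r ^ 2 < ∑ j, max (|V ω j| - τ) 0 ^ 2}
      ≤ μ {ω | ENNReal.ofReal (Real.exp (r ^ 2 / (4 * c))) ≤
          ENNReal.ofReal (Real.exp ((∑ j, max (|V ω j| - τ) 0 ^ 2) / (4 * c)))} := by
        refine measure_mono fun ω hω => ENNReal.ofReal_le_ofReal ?_
        gcongr
        exact le_of_lt hω
    _ ≤ ENNReal.ofReal (Real.exp (√2 * Fintype.card ι * Real.exp (-(τ ^ 2 / (4 * c))))) /
          ENNReal.ofReal (Real.exp (r ^ 2 / (4 * c))) := by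
        refine (meas_ge_le_lintegral_div (by fun_prop)
          (ENNReal.ofReal_pos.2 (Real.exp_pos _)).ne' ENNReal.ofReal_ne_top).trans ?_
        gcongr
        exact hV.lintegral_exp_sum_softThreshold_sq_le hc hτ
    _ = _ := by rw [← ENNReal.ofReal_div_of_pos (Real.exp_pos _), Real.exp_sub]

lemma measurableSet_forall_mem_inner_le {E : Type*} [NormedAddCommGroup E] [InnerProductSpace ℝ E]
    [MeasurableSpace E] [BorelSpace E] {V : Ω → E} (hV : Measurable V) (K : Set E) (b : ℝ) :
    MeasurableSet {ω | ∀ z ∈ K, inner ℝ (V ω) z ≤ b} := by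
  have hclosed : IsClosed {v : E | ∀ z ∈ K, inner ℝ v z ≤ b} := by
    simp only [Set.ofPred_forall]
    exact isClosed_biInter fun z _ => isClosed_le (by fun_prop) continuous_const
  exact hV hclosed.measurableSet

lemma sqrt_two_mul_exp_neg_sqrt_log_sq_div_le {n : ℕ} {s b : ℝ} (hs : 0 < s) (hb : 0 < b) :
    √2 * n * Real.exp (-(√(b * Real.log (2 * n / s)) ^ 2 / b)) ≤ s := by
  rcases Nat.eq_zero_or_pos n with rfl | hn
  · simpa using hs.le
  have hlog : Real.log (2 * n / s) ≤ √(b * Real.log (2 * n / s)) ^ 2 / b := by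
    rw [le_div_iff₀ hb, Real.sq_sqrt', mul_comm]
    exact le_max_left _ _
  calc √2 * n * Real.exp (-(√(b * Real.log (2 * n / s)) ^ 2 / b))
      ≤ √2 * n * Real.exp (-Real.log (2 * n / s)) := by gcongr
    _ = √2 / 2 * s := by
        rw [Real.exp_neg, Real.exp_log (by positivity)]
        field_simp
    _ ≤ 1 * s := by
        gcongr
        rw [div_le_one two_pos, Real.sqrt_le_left two_pos.le]
        norm_num
    _ = s := one_mul s

/- At the threshold `τ = √(4 c log (2n / s))` each of the `n` coordinates contributes at most
`s / n` to the exponential moment of the thresholded vector. -/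
lemma IsSubgaussianVector.le_measureReal_forall_mem_compressibleSet_inner_le
    [IsProbabilityMeasure μ] {n : ℕ} {V : Ω → EuclideanSpace ℝ (Fin n)}
    (hV : IsSubgaussianVector V c μ) (hV_meas : Measurable V) (hc : 0 < c) {s r : ℝ} (hs : 0 < s)
    (hr : 0 ≤ r) :
    1 - Real.exp (s - r ^ 2 / (4 * c)) ≤
      μ.real {ω | ∀ z ∈ compressibleSet n s,
        inner ℝ (V ω) z ≤ √(4 * c * Real.log (2 * n / s)) * √s + r} := by
  set τ := √(4 * c * Real.log (2 * n / s))
  set G := {ω | ∀ z ∈ compressibleSet n s, inner ℝ (V ω) z ≤ τ * √s + r}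
  have hcompl : Gᶜ ⊆ {ω | r ^ 2 < ∑ j, max (|V ω j| - τ) 0 ^ 2} := fun ω hω => by
    by_contra hle
    exact hω fun z hz =>
      inner_le_of_mem_compressibleSet (Real.sqrt_nonneg _) hr (not_lt.1 hle) hz
  have htail : μ.real Gᶜ ≤ Real.exp (s - r ^ 2 / (4 * c)) := by
    refine (measureReal_mono hcompl).trans
      ((hV.measureReal_lt_sum_softThreshold_sq_le hc (Real.sqrt_nonneg _) r).trans ?_)
    rw [Fintype.card_fin]
    gcongr
    exact sqrt_two_mul_exp_neg_sqrt_log_sq_div_le hs (by positivity)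
  rw [probReal_compl_eq_one_sub (measurableSet_forall_mem_inner_le hV_meas _ _)] at htail
  linarith

end SoftThreshold

/-! ### Conditional independence -/

section ConditionalIndependence

variable {Ω : Type*} {𝒜 mΩ : MeasurableSpace Ω} {μ : Measure Ω}

lemma setIntegral_condExp_indicator_one [IsFiniteMeasure μ] (h𝒜 : 𝒜 ≤ mΩ) {A D : Set Ω}
    (hA : MeasurableSet[𝒜] A) (hD : MeasurableSet D) :
    ∫ ω in A, (μ⟦D | 𝒜⟧) ω ∂μ = μ.real (A ∩ D) := by
  rw [setIntegral_condExp h𝒜 ((integrable_const _).indicator hD) hA, setIntegral_indicator hD,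
    setIntegral_const, smul_eq_mul, mul_one]

namespace CondIndepGiven

variable {ι : Type*} {β : ι → Type*} [∀ i, MeasurableSpace (β i)] {a : ∀ i, Ω → β i}
  {y : ι → Ω → ℝ}

lemma measureReal_biInter_inter [IsFiniteMeasure μ] (h : CondIndepGiven 𝒜 μ y) (h𝒜 : 𝒜 ≤ mΩ)
    (ha : ∀ i, Measurable[𝒜] (a i)) (ha_indep : iIndepFun a μ) (hy : ∀ i, Measurable (y i))
    (hcond : ∀ i B, MeasurableSet B →
      ∃ g : β i → ℝ, Measurable g ∧ μ⟦y i ⁻¹' B | 𝒜⟧ =ᵐ[μ] fun ω => g (a i ω))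
    (S : Finset ι) {A : ∀ i, Set (β i)} {B : ι → Set ℝ} (hA : ∀ i ∈ S, MeasurableSet (A i))
    (hB : ∀ i ∈ S, MeasurableSet (B i)) :
    μ.real (⋂ i ∈ S, a i ⁻¹' A i ∩ y i ⁻¹' B i) =
      ∏ i ∈ S, μ.real (a i ⁻¹' A i ∩ y i ⁻¹' B i) := by
  have hA' i (hi : i ∈ S) : MeasurableSet[𝒜] (a i ⁻¹' A i) := ha i (hA i hi)
  choose! g hg hgy using fun i (hi : i ∈ S) => hcond i (B i) (hB i hi)
  have hprod : ∀ᵐ ω ∂μ, (μ⟦⋂ i ∈ S, y i ⁻¹' B i | 𝒜⟧) ω = ∏ i ∈ S, g i (a i ω) := by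
    filter_upwards [h S B hB, (Filter.eventually_all_finset S).2 hgy] with ω hω hgω
    rw [hω, Finset.prod_apply]
    exact Finset.prod_congr rfl hgω
  have hindep : iIndepFun (fun (i : S) ω => (A i).indicator (g i) (a i ω)) μ :=
    (ha_indep.precomp Subtype.val_injective).comp (fun i : S => (A i).indicator (g i))
      fun i => (hg i i.2).indicator (hA i i.2)
  calc μ.real (⋂ i ∈ S, a i ⁻¹' A i ∩ y i ⁻¹' B i)
      = ∫ ω in ⋂ i ∈ S, a i ⁻¹' A i, (μ⟦⋂ i ∈ S, y i ⁻¹' B i | 𝒜⟧) ω ∂μ := by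
        rw [setIntegral_condExp_indicator_one h𝒜 (Finset.measurableSet_biInter S hA')
          (Finset.measurableSet_biInter S fun i hi => hy i (hB i hi))]
        simp only [Set.iInter_inter_distrib]
    _ = ∫ ω in ⋂ i ∈ S, a i ⁻¹' A i, ∏ i ∈ S, g i (a i ω) ∂μ :=
        integral_congr_ae (ae_restrict_of_ae hprod)
    _ = ∫ ω, ∏ i : S, (A i).indicator (g i) (a i ω) ∂μ := by
        rw [← integral_indicator (Finset.measurableSet_biInter S fun i hi => h𝒜 _ (hA' i hi))]
        refine integral_congr_ae (ae_of_all _ fun ω => ?_)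
        rw [← Finset.prod_fn]
        exact (prod_indicator_apply S (fun i => a i ⁻¹' A i) (fun i ω => g i (a i ω)) ω).symm.trans
          (Finset.prod_coe_sort S fun i => (A i).indicator (g i) (a i ω)).symm
    _ = ∏ i : S, ∫ ω, (A i).indicator (g i) (a i ω) ∂μ :=
        hindep.integral_fun_prod_eq_prod_integral fun i =>
          (((hg i i.2).indicator (hA i i.2)).comp ((ha i).mono h𝒜 le_rfl)).aestronglyMeasurable
    _ = ∏ i ∈ S, μ.real (a i ⁻¹' A i ∩ y i ⁻¹' B i) := by
        rw [Finset.prod_coe_sort S fun i => ∫ ω, (A i).indicator (g i) (a i ω) ∂μ]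
        refine Finset.prod_congr rfl fun i hi => ?_
        rw [← setIntegral_condExp_indicator_one h𝒜 (hA' i hi) (hy i (hB i hi)),
          ← integral_indicator (h𝒜 _ (hA' i hi))]
        refine integral_congr_ae ?_
        filter_upwards [hgy i hi] with ω hω
        simp only [Set.indicator, hω]
        rfl

lemma iIndepFun_prodMk [IsProbabilityMeasure μ] (h : CondIndepGiven 𝒜 μ y) (h𝒜 : 𝒜 ≤ mΩ)
    (ha : ∀ i, Measurable[𝒜] (a i)) (ha_indep : iIndepFun a μ) (hy : ∀ i, Measurable (y i))
    (hcond : ∀ i B, MeasurableSet B →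
      ∃ g : β i → ℝ, Measurable g ∧ μ⟦y i ⁻¹' B | 𝒜⟧ =ᵐ[μ] fun ω => g (a i ω)) :
    iIndepFun (fun i ω => (a i ω, y i ω)) μ := by
  have hmeas i : Measurable fun ω => (a i ω, y i ω) := ((ha i).mono h𝒜 le_rfl).prodMk (hy i)
  rw [iIndepFun_iff_iIndep]
  refine iIndepSets.iIndep (fun i => (hmeas i).comap_le)
    (fun i => Set.preimage (fun ω => (a i ω, y i ω)) ''
      Set.image2 (· ×ˢ ·) {A | MeasurableSet A} {B | MeasurableSet B})
    (fun i => isPiSystem_prod.comap _)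
    (fun i => by rw [← generateFrom_prod, MeasurableSpace.comap_generateFrom]) ?_
  rw [iIndepSets_iff]
  intro S f hf
  have hf' i (hi : i ∈ S) : ∃ A B, MeasurableSet A ∧ MeasurableSet B ∧
      f i = a i ⁻¹' A ∩ y i ⁻¹' B := by
    obtain ⟨_, ⟨A, hA, B, hB, rfl⟩, hf⟩ := hf i hi
    exact ⟨A, B, hA, hB, hf.symm⟩
  choose! A B hA hB hAB using hf'
  rw [← ENNReal.toReal_eq_toReal_iff' (measure_ne_top _ _)
    (ENNReal.prod_ne_top fun i _ => measure_ne_top _ _), ENNReal.toReal_prod,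
    Set.iInter₂_congr hAB, Finset.prod_congr rfl fun i hi => by rw [hAB i hi]]
  exact h.measureReal_biInter_inter h𝒜 ha ha_indep hy hcond S hA hB

end CondIndepGiven

end ConditionalIndependence

section SubgaussianVectorOperations

variable {Ω : Type*} [MeasurableSpace Ω] {μ : Measure Ω}
  {E : Type*} [NormedAddCommGroup E] [InnerProductSpace ℝ E]

namespace IsSubgaussianVector

lemma smul_sub [IsProbabilityMeasure μ] {g : Ω → E} {c : NNReal} (hg : IsSubgaussianVector g c μ)
    {y : Ω → ℝ} (hy : AEMeasurable y μ) (hy_le : ∀ᵐ ω ∂μ, |y ω| ≤ 1) {w : E}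
    (hw : ∀ θ, ∫ ω, y ω * inner ℝ (g ω) θ ∂μ = inner ℝ w θ) :
    IsSubgaussianVector (fun ω => y ω • g ω - w) (2 * c) μ := by
  intro θ
  simp only [inner_sub_left, real_inner_smul_left, ← hw θ, mul_assoc 2 c]
  refine hasSubgaussianMGF_sub_integral_of_ae_abs_le (hy.mul (hg θ).aemeasurable) (hg θ) ?_
  filter_upwards [hy_le] with ω hω
  rw [abs_mul]
  exact mul_le_of_le_one_left (abs_nonneg _) hω

lemma sum [MeasurableSpace E] [OpensMeasurableSpace E] {ι : Type*} [Fintype ι] {V : ι → Ω → E}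
    {c : ι → NNReal} (hV : ∀ i, IsSubgaussianVector (V i) (c i) μ) (h_indep : iIndepFun V μ) :
    IsSubgaussianVector (fun ω => ∑ i, V i ω) (∑ i, c i) μ := by
  intro θ
  simp only [sum_inner, Finset.sum_mul]
  have hmeas : Measurable fun v : E => inner ℝ v θ :=
    (by fun_prop : Continuous fun v : E => inner ℝ v θ).measurable
  exact HasSubgaussianMGF.sum_of_iIndepFun (h_indep.comp (fun _ v => inner ℝ v θ) fun _ => hmeas)
    fun i _ => hV i θ

end IsSubgaussianVector

end SubgaussianVectorOperations

/-! ### Standard Gaussian vectors -/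

section StdGaussian

variable {E : Type*} [NormedAddCommGroup E] [InnerProductSpace ℝ E] [FiniteDimensional ℝ E]
  [MeasurableSpace E] [BorelSpace E]

lemma measurePreserving_inner_stdGaussian (θ : E) :
    MeasurePreserving (fun g => inner ℝ g θ) (stdGaussian E) (gaussianReal 0 (‖θ‖₊ ^ 2)) := by
  refine ⟨by fun_prop, ?_⟩
  have hmap := IsGaussian.map_eq_gaussianReal (μ := stdGaussian E) (innerSL ℝ θ)
  rw [integral_strongDual_stdGaussian, variance_dual_stdGaussian, innerSL_apply_norm] at hmap
  simp only [← real_inner_comm _ θ]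
  rwa [Real.toNNReal_pow (norm_nonneg θ), norm_toNNReal] at hmap

lemma isSubgaussianVector_of_hasLaw_stdGaussian {Ω : Type*} [MeasurableSpace Ω] {μ : Measure Ω}
    {g : Ω → E} (hg : HasLaw g (stdGaussian E) μ) : IsSubgaussianVector g 1 μ := by
  intro θ
  have hlaw : HasLaw (fun ω => inner ℝ (g ω) θ) (gaussianReal 0 (‖θ‖₊ ^ 2)) μ :=
    (measurePreserving_inner_stdGaussian θ).hasLaw.comp hg
  rw [one_mul]
  refine ⟨fun t => ?_, fun t => ?_⟩
  · have hint := integrable_exp_mul_gaussianReal (μ := 0) (v := ‖θ‖₊ ^ 2) t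
    rw [← hlaw.map_eq] at hint
    exact hint.comp_aemeasurable hlaw.aemeasurable
  · rw [mgf_gaussianReal hlaw.map_eq, zero_mul, zero_add]

lemma integral_comp_inner_mul_inner_stdGaussian_of_inner_eq_zero {u w : E} (huw : inner ℝ u w = 0)
    (φ : ℝ → ℝ) : ∫ g, φ (inner ℝ g u) * inner ℝ g w ∂stdGaussian E = 0 := by
  set R := (ℝ ∙ u).reflection
  have hsymm (g v : E) : inner ℝ (R g) v = inner ℝ g (R v) := by
    rw [← R.inner_map_map, Submodule.reflection_reflection]
  have hRu : R u = u :=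
    Submodule.reflection_mem_subspace_eq_self (Submodule.mem_span_singleton_self u)
  have hRw : R w = -w := Submodule.reflection_mem_subspace_orthogonalComplement_eq_neg
    (Submodule.mem_orthogonal_singleton_iff_inner_right.2 huw)
  have hpres : MeasurePreserving R (stdGaussian E) (stdGaussian E) :=
    ⟨R.continuous.measurable, stdGaussian_map R⟩
  have hodd := hpres.integral_comp R.toHomeomorph.measurableEmbedding
    fun g => φ (inner ℝ g u) * inner ℝ g w
  simp only [hsymm, hRu, hRw, inner_neg_right, mul_neg, integral_neg] at hodd
  linarith

lemma integral_comp_inner_mul_inner_stdGaussian {u : E} (hu : ‖u‖ = 1) {φ : ℝ → ℝ}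
    (hφ : MemLp φ 2 (gaussianReal 0 1)) (θ : E) :
    ∫ g, φ (inner ℝ g u) * inner ℝ g θ ∂stdGaussian E =
      inner ℝ u θ * ∫ t, φ t * t ∂gaussianReal 0 1 := by
  have hpres : MeasurePreserving (fun g => inner ℝ g u) (stdGaussian E) (gaussianReal 0 1) := by
    have hu' : ‖u‖₊ = 1 := NNReal.eq hu
    simpa only [hu', one_pow] using measurePreserving_inner_stdGaussian u
  have hφ_meas : AEStronglyMeasurable φ (gaussianReal 0 1) := hφ.aestronglyMeasurable
  have hint (v : E) : Integrable (fun g => φ (inner ℝ g u) * inner ℝ g v) (stdGaussian E) :=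
    (hφ.comp_measurePreserving hpres).integrable_mul
      ((IsGaussian.memLp_two_id (μ := stdGaussian E)).inner_const v)
  have horth : inner ℝ u (θ - inner ℝ u θ • u) = 0 := by
    rw [inner_sub_right, real_inner_smul_right, real_inner_self_eq_norm_sq, hu]
    ring
  calc ∫ g, φ (inner ℝ g u) * inner ℝ g θ ∂stdGaussian E
      = ∫ g, (inner ℝ u θ * (φ (inner ℝ g u) * inner ℝ g u) +
          φ (inner ℝ g u) * inner ℝ g (θ - inner ℝ u θ • u)) ∂stdGaussian E := by
        congr 1 with g
        rw [inner_sub_right, real_inner_smul_right]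
        ring
    _ = inner ℝ u θ * ∫ g, φ (inner ℝ g u) * inner ℝ g u ∂stdGaussian E := by
        rw [integral_add ((hint u).const_mul _) (hint _), integral_const_mul,
          integral_comp_inner_mul_inner_stdGaussian_of_inner_eq_zero horth, add_zero]
    _ = inner ℝ u θ * ∫ t, φ t * t ∂gaussianReal 0 1 := by
        rw [← hpres.hasLaw.integral_comp (by fun_prop), Function.comp_def]

end StdGaussian

/-! ### The logistic function -/

section Logistic

lemma logisticFun_pos (t : ℝ) : 0 < logisticFun t :=
  div_pos (Real.exp_pos t) (by positivity)

lemma logisticFun_lt_one (t : ℝ) : logisticFun t < 1 :=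
  (div_lt_one (by positivity)).2 (lt_add_one _)

lemma continuous_logisticFun : Continuous logisticFun :=
  Real.continuous_exp.div (by fun_prop) fun t => by positivity

lemma logisticFun_neg (t : ℝ) : logisticFun (-t) = 1 - logisticFun t := by
  unfold logisticFun
  rw [Real.exp_neg]
  have := Real.exp_pos t
  field_simp
  ring

lemma abs_two_mul_logisticFun_sub_one_le (t : ℝ) : |2 * logisticFun t - 1| ≤ 1 := by
  rw [abs_le]
  constructor <;> linarith [logisticFun_pos t, logisticFun_lt_one t]

lemma div_two_add_le_two_mul_logisticFun_sub_one {t : ℝ} (ht : 0 ≤ t) :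
    t / (2 + t) ≤ 2 * logisticFun t - 1 := by
  have hexp : t + 1 ≤ Real.exp t := Real.add_one_le_exp t
  have hodd : 2 * logisticFun t - 1 = (Real.exp t - 1) / (Real.exp t + 1) := by
    unfold logisticFun
    field_simp
    ring
  rw [hodd, div_le_div_iff₀ (by positivity) (by positivity)]
  nlinarith

lemma min_one_div_le_div {r z : ℝ} (hr : 0 ≤ r) (hz : 0 ≤ z) :
    min r 1 / (2 + z) ≤ r / (2 + r * z) := by
  rw [div_le_div_iff₀ (by positivity) (by positivity)]
  rcases le_total r 1 with h | h
  · rw [min_eq_left h]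
    nlinarith [mul_nonneg (mul_nonneg hr hz) (sub_nonneg.2 h)]
  · rw [min_eq_right h]
    nlinarith

lemma min_mul_le_two_mul_logisticFun_sub_one_mul {r : ℝ} (hr : 0 ≤ r) (z : ℝ) :
    min r 1 * (z ^ 2 / (2 + |z|)) ≤ (2 * logisticFun (r * z) - 1) * z := by
  wlog hz : 0 ≤ z generalizing z
  · have hneg := this (-z) (by linarith)
    rw [abs_neg, mul_neg, mul_neg, logisticFun_neg, neg_sq] at hneg
    linarith
  rw [abs_of_nonneg hz]
  calc min r 1 * (z ^ 2 / (2 + z)) = min r 1 / (2 + z) * z ^ 2 := by ring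
    _ ≤ r / (2 + r * z) * z ^ 2 := by gcongr ?_ * _; exact min_one_div_le_div hr hz
    _ = r * z / (2 + r * z) * z := by ring
    _ ≤ (2 * logisticFun (r * z) - 1) * z := by
        gcongr
        exact div_two_add_le_two_mul_logisticFun_sub_one (mul_nonneg hr hz)

lemma integrable_sq_div_gaussianReal :
    Integrable (fun z : ℝ => z ^ 2 / (2 + |z|)) (gaussianReal 0 1) := by
  have habs : Integrable (fun z : ℝ => |z|) (gaussianReal 0 1) :=
    (IsGaussian.integrable_id (μ := gaussianReal 0 1)).abs
  refine habs.mono' (by fun_prop : Measurable _).aestronglyMeasurable (ae_of_all _ fun z => ?_)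
  rw [Real.norm_of_nonneg (by positivity), div_le_iff₀ (by positivity), ← sq_abs]
  nlinarith [abs_nonneg z]

lemma integral_sq_div_gaussianReal_pos :
    0 < ∫ z : ℝ, z ^ 2 / (2 + |z|) ∂gaussianReal 0 1 := by
  rw [integral_pos_iff_support_of_nonneg (fun z => by positivity) integrable_sq_div_gaussianReal]
  have hsupport : Function.support (fun z : ℝ => z ^ 2 / (2 + |z|)) = {0}ᶜ := by
    ext z
    have hz : 2 + |z| ≠ 0 := by positivity
    simp [hz]
  have := nullSingletonClass_gaussianReal (μ := 0) (one_ne_zero (α := NNReal))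
  rw [hsupport, prob_compl_eq_one_sub (measurableSet_singleton _)]
  simp

lemma memLp_two_mul_logisticFun_sub_one {ν : Measure ℝ} [IsFiniteMeasure ν] (r : ℝ)
    (p : ENNReal) : MemLp (fun z => 2 * logisticFun (r * z) - 1) p ν := by
  have := continuous_logisticFun
  exact MemLp.of_bound (by fun_prop : Continuous _).aestronglyMeasurable 1
    (ae_of_all _ fun z => abs_two_mul_logisticFun_sub_one_le _)

/-- The correlation `λ = 𝔼[(2 f(r g) - 1) g]`, for `g` a standard Gaussian variable, of a
`{-1, 1}`-valued label of mean `2 f(r g) - 1` with `g`. In the logistic model with `r = ‖x‖₂`, the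
vector `yᵢ aᵢ` has mean `λ x / ‖x‖₂`. -/
noncomputable def logisticCorrelation (r : ℝ) : ℝ :=
  ∫ z, (2 * logisticFun (r * z) - 1) * z ∂gaussianReal 0 1

lemma min_mul_integral_le_logisticCorrelation {r : ℝ} (hr : 0 ≤ r) :
    min r 1 * ∫ z : ℝ, z ^ 2 / (2 + |z|) ∂gaussianReal 0 1 ≤ logisticCorrelation r := by
  rw [logisticCorrelation, ← integral_const_mul]
  exact integral_mono (integrable_sq_div_gaussianReal.const_mul _)
    ((memLp_two_mul_logisticFun_sub_one r 2).integrable_mul IsGaussian.memLp_two_id)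
    (min_mul_le_two_mul_logisticFun_sub_one_mul hr)

end Logistic

/-! ### The logistic model -/

section Model

variable {Ω : Type*} {n m : ℕ} {x : EuclideanSpace ℝ (Fin n)}
  {a : Fin m → Ω → EuclideanSpace ℝ (Fin n)} {y : Fin m → Ω → ℝ}

lemma measurable_measurementSigma (a : Fin m → Ω → EuclideanSpace ℝ (Fin n)) (i : Fin m) :
    Measurable[measurementSigma a] (a i) :=
  measurable_iff_comap_le.2 (le_iSup (fun i => MeasurableSpace.comap (a i) inferInstance) i)

variable [MeasurableSpace Ω] {μ : Measure Ω}

namespace IsGaussianLogisticModel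

lemma measurementSigma_le (h : IsGaussianLogisticModel μ x a y) :
    measurementSigma a ≤ ‹MeasurableSpace Ω› :=
  iSup_le fun i => (h.measurable_a i).comap_le

lemma abs_y_le (h : IsGaussianLogisticModel μ x a y) (i : Fin m) (ω : Ω) : |y i ω| ≤ 1 := by
  rcases h.sign_y i ω with hy | hy <;> simp [hy]

lemma isSubgaussianVector_a (h : IsGaussianLogisticModel μ x a y) (i : Fin m) :
    IsSubgaussianVector (a i) 1 μ :=
  isSubgaussianVector_of_hasLaw_stdGaussian (h.gaussian_a i)

lemma measurable_sum_smul_sub (h : IsGaussianLogisticModel μ x a y)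
    (w : EuclideanSpace ℝ (Fin n)) : Measurable fun ω => ∑ i, y i ω • a i ω - w := by
  have ha := h.measurable_a
  have hy := h.measurable_y
  fun_prop

variable [IsProbabilityMeasure μ]

lemma condExp_comp_y (h : IsGaussianLogisticModel μ x a y) (i : Fin m) (φ : ℝ → ℝ) :
    μ[fun ω => φ (y i ω) | measurementSigma a] =ᵐ[μ]
      fun ω => φ (-1) + (φ 1 - φ (-1)) * logisticFun (inner ℝ (a i ω) x) := by
  have hφ : (fun ω => φ (y i ω)) = (fun _ => φ (-1)) +
      (φ 1 - φ (-1)) • (y i ⁻¹' {1}).indicator fun _ => (1 : ℝ) := by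
    ext ω
    rcases h.sign_y i ω with hy | hy <;> norm_num [Set.indicator, hy]
  have hint : Integrable ((y i ⁻¹' {1}).indicator fun _ => (1 : ℝ)) μ :=
    (integrable_const _).indicator (h.measurable_y i (measurableSet_singleton _))
  rw [hφ]
  filter_upwards [condExp_add (integrable_const (φ (-1))) (hint.smul (φ 1 - φ (-1)))
    (measurementSigma a), condExp_smul (φ 1 - φ (-1)) ((y i ⁻¹' {1}).indicator fun _ => (1 : ℝ))
    (measurementSigma a), h.prob_y i] with ω hadd hsmul hprob
  rw [hadd, Pi.add_apply, hsmul, Pi.smul_apply, hprob, condExp_const h.measurementSigma_le,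
    smul_eq_mul]

lemma iIndepFun_prodMk (h : IsGaussianLogisticModel μ x a y) :
    iIndepFun (fun i ω => (a i ω, y i ω)) μ := by
  refine h.condIndep_y.iIndepFun_prodMk h.measurementSigma_le (measurable_measurementSigma a)
    h.indep_a h.measurable_y fun i B _ => ?_
  set φ : ℝ → ℝ := B.indicator fun _ => 1
  have := continuous_logisticFun.measurable
  exact ⟨fun v => φ (-1) + (φ 1 - φ (-1)) * logisticFun (inner ℝ v x), by fun_prop,
    h.condExp_comp_y i φ⟩

lemma integral_y_mul_inner (h : IsGaussianLogisticModel μ x a y) (i : Fin m)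
    (θ : EuclideanSpace ℝ (Fin n)) :
    ∫ ω, y i ω * inner ℝ (a i ω) θ ∂μ =
      ∫ g, (2 * logisticFun (inner ℝ g x) - 1) * inner ℝ g θ
        ∂stdGaussian (EuclideanSpace ℝ (Fin n)) := by
  have hy_int : Integrable (y i) μ :=
    Integrable.of_bound (h.measurable_y i).aestronglyMeasurable 1 (ae_of_all _ (h.abs_y_le i))
  have ha_int : Integrable (fun ω => inner ℝ (a i ω) θ) μ :=
    (h.isSubgaussianVector_a i θ).integrable
  have ha_meas : StronglyMeasurable[measurementSigma a] fun ω => inner ℝ (a i ω) θ :=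
    ((by fun_prop : Measurable fun v => inner ℝ v θ).comp
      (measurable_measurementSigma a i)).stronglyMeasurable
  have hpull := condExp_mul_of_stronglyMeasurable_right ha_meas
    (ha_int.bdd_mul hy_int.aestronglyMeasurable (ae_of_all _ (h.abs_y_le i))) hy_int
  have hlogistic := continuous_logisticFun
  calc ∫ ω, y i ω * inner ℝ (a i ω) θ ∂μ
      = ∫ ω, (μ[y i * fun ω => inner ℝ (a i ω) θ | measurementSigma a]) ω ∂μ :=
        (integral_condExp h.measurementSigma_le).symm
    _ = ∫ ω, (2 * logisticFun (inner ℝ (a i ω) x) - 1) * inner ℝ (a i ω) θ ∂μ := by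
        refine integral_congr_ae ?_
        filter_upwards [hpull, h.condExp_comp_y i id] with ω hω hyω
        simp only [id] at hyω
        rw [hω, Pi.mul_apply, hyω]
        ring
    _ = ∫ g, (2 * logisticFun (inner ℝ g x) - 1) * inner ℝ g θ
          ∂stdGaussian (EuclideanSpace ℝ (Fin n)) :=
        (h.gaussian_a i).integral_comp
          (f := fun g => (2 * logisticFun (inner ℝ g x) - 1) * inner ℝ g θ)
          (by fun_prop : Continuous _).aestronglyMeasurable

lemma integral_y_mul_inner_eq_inner (h : IsGaussianLogisticModel μ x a y) (hx : x ≠ 0)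
    (i : Fin m) (θ : EuclideanSpace ℝ (Fin n)) :
    ∫ ω, y i ω * inner ℝ (a i ω) θ ∂μ =
      inner ℝ (logisticCorrelation ‖x‖ • ‖x‖⁻¹ • x) θ := by
  have hinner (g : EuclideanSpace ℝ (Fin n)) : inner ℝ g x = ‖x‖ * inner ℝ g (‖x‖⁻¹ • x) := by
    rw [real_inner_smul_right, mul_inv_cancel_left₀ (norm_ne_zero_iff.2 hx)]
  have hnorm : ‖‖x‖⁻¹ • x‖ = 1 := norm_smul_inv_norm hx
  rw [h.integral_y_mul_inner]
  simp only [hinner]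
  rw [integral_comp_inner_mul_inner_stdGaussian hnorm
    (memLp_two_mul_logisticFun_sub_one ‖x‖ 2), ← logisticCorrelation,
    real_inner_smul_left _ _ (logisticCorrelation _), mul_comm]

lemma isSubgaussianVector_sum_smul_sub (h : IsGaussianLogisticModel μ x a y) (hx : x ≠ 0) :
    IsSubgaussianVector
      (fun ω => ∑ i, y i ω • a i ω - (m * logisticCorrelation ‖x‖) • ‖x‖⁻¹ • x) (2 * m) μ := by
  set w := logisticCorrelation ‖x‖ • ‖x‖⁻¹ • x
  have hterm i : IsSubgaussianVector (fun ω => y i ω • a i ω - w) (2 * 1) μ :=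
    (h.isSubgaussianVector_a i).smul_sub (h.measurable_y i).aemeasurable
      (ae_of_all _ (h.abs_y_le i)) (h.integral_y_mul_inner_eq_inner hx i)
  have hindep : iIndepFun (fun i ω => y i ω • a i ω - w) μ :=
    h.iIndepFun_prodMk.comp (fun _ p => p.2 • p.1 - w) fun _ => by fun_prop
  convert IsSubgaussianVector.sum hterm hindep using 1
  · ext1 ω
    simp [Finset.sum_sub_distrib, w, mul_smul, Nat.cast_smul_eq_nsmul]
  · simp [mul_comm]

lemma le_measureReal_forall_mem_compressibleSet_inner_le (h : IsGaussianLogisticModel μ x a y)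
    (hx : x ≠ 0) (hm : 0 < m) {s r : ℝ} (hs : 0 < s) (hr : 0 ≤ r) :
    1 - Real.exp (s - r ^ 2 / (8 * m)) ≤
      μ.real {ω | ∀ w ∈ compressibleSet n s,
        inner ℝ (∑ i, y i ω • a i ω - (m * logisticCorrelation ‖x‖) • ‖x‖⁻¹ • x) w ≤
          √(8 * m * Real.log (2 * n / s)) * √s + r} := by
  have hc : 4 * ((2 * m : NNReal) : ℝ) = 8 * m := by
    push_cast
    ring
  rw [← hc]
  exact (h.isSubgaussianVector_sum_smul_sub hx).le_measureReal_forall_mem_compressibleSet_inner_le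
    (h.measurable_sum_smul_sub _) (by positivity) hs hr

end IsGaussianLogisticModel

end Model

/-! ### The convex program -/

section Program

variable {n m : ℕ} {s : ℝ} {a : Fin m → EuclideanSpace ℝ (Fin n)} {y : Fin m → ℝ}

lemma exists_isProgramSolution (hK : (compressibleSet n s).Nonempty)
    (a : Fin m → EuclideanSpace ℝ (Fin n)) (y : Fin m → ℝ) : ∃ z, IsProgramSolution s a y z :=
  isCompact_compressibleSet.exists_isMaxOn hK (by fun_prop)

/- Optimality of `z` against `u` bounds `l * (1 - ⟪u, z⟫)` by the inner product of
`∑ yᵢ aᵢ - l u` with `z - u`, and `‖z - u‖² ≤ 2 (1 - ⟪u, z⟫)` as `z` lies in the unit ball. -/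
lemma IsProgramSolution.mul_norm_sub_sq_le {z u : EuclideanSpace ℝ (Fin n)}
    (hz : IsProgramSolution s a y z) (hu : ‖u‖ = 1) (huK : u ∈ compressibleSet n s) {l t : ℝ}
    (hl : 0 ≤ l) (hV : ∀ w ∈ compressibleSet n s, inner ℝ (∑ i, y i • a i - l • u) w ≤ t) :
    l * ‖z - u‖ ^ 2 ≤ 4 * t := by
  have hopt : inner ℝ (∑ i, y i • a i) u ≤ inner ℝ (∑ i, y i • a i) z := by
    simpa [sum_inner, real_inner_smul_left] using hz.2 huK
  have hVz := hV z hz.1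
  have hVu := hV (-u) (neg_mem_compressibleSet huK)
  simp only [inner_sub_left, inner_neg_right, real_inner_smul_left, real_inner_self_eq_norm_sq,
    hu] at hVz hVu
  have hdist : ‖z - u‖ ^ 2 ≤ 2 - 2 * inner ℝ u z := by
    rw [norm_sub_sq_real, hu, real_inner_comm]
    nlinarith [hz.1.1, norm_nonneg z]
  nlinarith [mul_le_mul_of_nonneg_left hdist hl]

end Program

section SampleSize

lemma le_and_mul_log_le_of_sampleSize {κ δ s L M : ℝ} (hκ : 0 < κ) (hδ : 0 < δ) (hs : 0 ≤ s)
    (hL : Real.log 2 ≤ L) (hM : 1024 / (κ ^ 2 * Real.log 2) * δ⁻¹ ^ 2 * s * L ≤ M) :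
    1024 * s ≤ (κ * δ) ^ 2 * M ∧ 1024 * (s * L) ≤ (κ * δ) ^ 2 * M := by
  have hlog : 0 < Real.log 2 := Real.log_pos one_lt_two
  have hlog_le : Real.log 2 ≤ 1 := by linarith [Real.log_two_lt_d9]
  have hsL : 1024 * (s * L) / Real.log 2 ≤ (κ * δ) ^ 2 * M := by
    calc 1024 * (s * L) / Real.log 2
        = (κ * δ) ^ 2 * (1024 / (κ ^ 2 * Real.log 2) * δ⁻¹ ^ 2 * s * L) := by field_simp
      _ ≤ (κ * δ) ^ 2 * M := by gcongr
  constructor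
  · refine le_trans ((le_div_iff₀ hlog).2 ?_) hsL
    rw [mul_assoc]
    gcongr
  · refine le_trans ?_ hsL
    rw [le_div_iff₀ hlog]
    exact mul_le_of_le_one_right (by have := hlog.le.trans hL; positivity) hlog_le

lemma sqrt_mul_sqrt_le_of_mul_le {b s L M : ℝ} (hb : 0 ≤ b) (hs : 0 ≤ s) (hM : 0 ≤ M)
    (hsL : 1024 * (s * L) ≤ b ^ 2 * M) : √(8 * M * L) * √s ≤ b * M / 8 := by
  rw [← Real.sqrt_mul' _ hs, Real.sqrt_le_left (by positivity)]
  nlinarith [mul_le_mul_of_nonneg_left hsL hM, mul_nonneg (mul_nonneg hM hM) (sq_nonneg b)]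

lemma exp_sub_sq_div_le_of_le {κ δ s M : ℝ} (hM : 0 < M) (hs : 1024 * s ≤ (κ * δ) ^ 2 * M) :
    Real.exp (s - (κ * δ * M / 8) ^ 2 / (8 * M)) ≤ Real.exp (-(κ ^ 2 / 1024 * δ ^ 2 * M)) := by
  have hsq : (κ * δ * M / 8) ^ 2 / (8 * M) = (κ * δ) ^ 2 * M / 512 := by
    field_simp
    norm_num
  rw [hsq]
  gcongr
  linarith

lemma le_mul_max_inv_one {ρ D δ : ℝ} (hρ : 0 < ρ) (h : min ρ 1 * D ≤ δ) :
    D ≤ δ * max ρ⁻¹ 1 := by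
  have hinv : max ρ⁻¹ 1 = (min ρ 1)⁻¹ := by
    rcases le_total ρ 1 with hρ1 | hρ1
    · rw [min_eq_left hρ1, max_eq_left ((one_le_inv₀ hρ).2 hρ1)]
    · rw [min_eq_right hρ1, max_eq_right (inv_le_one_of_one_le₀ hρ1), inv_one]
  rwa [hinv, le_mul_inv_iff₀ (lt_min hρ one_pos), mul_comm]

end SampleSize

theorem mainTheorem5 :
    ∃ C : ℝ, 0 < C ∧ ∃ c : ℝ, 0 < c ∧
      ∀ (Ω : Type*) [MeasurableSpace Ω] (μ : Measure Ω) [IsProbabilityMeasure μ]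
        (n m : ℕ) (s : ℝ), s ≤ n →
        ∀ x : EuclideanSpace ℝ (Fin n), x ≠ 0 → ‖x‖⁻¹ • x ∈ compressibleSet n s →
        ∀ (a : Fin m → Ω → EuclideanSpace ℝ (Fin n)) (y : Fin m → Ω → ℝ),
        IsGaussianLogisticModel μ x a y →
        ∀ δ : ℝ, 0 < δ → C * δ⁻¹ ^ 2 * s * Real.log (2 * n / s) ≤ m →
        ∃ E : Set Ω, MeasurableSet E ∧ 1 - 8 * Real.exp (-(c * δ ^ 2 * m)) ≤ μ.real E ∧
          ∀ ω ∈ E,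
            (∃ z, IsProgramSolution s (fun i => a i ω) (fun i => y i ω) z) ∧
            ∀ z, IsProgramSolution s (fun i => a i ω) (fun i => y i ω) z →
              ‖z - ‖x‖⁻¹ • x‖ ^ 2 ≤ δ * max ‖x‖⁻¹ 1 := by
  set κ := ∫ z : ℝ, z ^ 2 / (2 + |z|) ∂gaussianReal 0 1
  have hκ : 0 < κ := integral_sq_div_gaussianReal_pos
  have : 0 < Real.log 2 := Real.log_pos one_lt_two
  refine ⟨1024 / (κ ^ 2 * Real.log 2), by positivity, κ ^ 2 / 1024, by positivity, ?_⟩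
  intro Ω _ μ _ n m s hsn x hx hxK a y h δ hδ hm_ge
  have hx_pos : 0 < ‖x‖ := norm_pos_iff.2 hx
  have hu : ‖‖x‖⁻¹ • x‖ = 1 := norm_smul_inv_norm hx
  have hs : 0 < s := one_pos.trans_le (one_le_of_mem_compressibleSet hu hxK)
  have hlog_le : Real.log 2 ≤ Real.log (2 * n / s) := by gcongr; rw [le_div_iff₀ hs]; linarith
  obtain ⟨hs_le, hsL_le⟩ := le_and_mul_log_le_of_sampleSize hκ hδ hs.le hlog_le hm_ge
  have hm : (0 : ℝ) < m := pos_of_mul_pos_right (by linarith) (sq_nonneg (κ * δ))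
  have hdev := sqrt_mul_sqrt_le_of_mul_le (by positivity) hs.le hm.le hsL_le
  have hcorr := min_mul_integral_le_logisticCorrelation hx_pos.le
  have hcorr_nonneg : 0 ≤ logisticCorrelation ‖x‖ := le_trans (by positivity) hcorr
  -- With `r = κ δ m / 8`, both terms `√(8 m log (2n / s)) √s` and `r` are at most `κ δ m / 8`.
  refine ⟨_, measurableSet_forall_mem_inner_le (h.measurable_sum_smul_sub _) _ _, le_trans ?_
    (h.le_measureReal_forall_mem_compressibleSet_inner_le hx (by exact_mod_cast hm) hs
      (r := κ * δ * m / 8) (by positivity)), fun ω hω =>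
    ⟨exists_isProgramSolution ⟨_, hxK⟩ _ _, fun z hz => le_mul_max_inv_one hx_pos ?_⟩⟩
  · linarith [exp_sub_sq_div_le_of_le hm hs_le, Real.exp_pos (-(κ ^ 2 / 1024 * δ ^ 2 * m))]
  · have herr := hz.mul_norm_sub_sq_le hu hxK (by positivity) hω
    refine le_of_mul_le_mul_left ?_ (mul_pos hm hκ)
    nlinarith [mul_le_mul_of_nonneg_right hcorr (by positivity : 0 ≤ m * ‖z - ‖x‖⁻¹ • x‖ ^ 2)]
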